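/- Let $V$ be a finite-dimensional complex vector space, $\Lambda\subset V$ a lattice of full rank, and $X=V/\Lambda$ the corresponding complex torus, regarded as a smooth real manifold. Let $C_k(X)$ be the group of smooth singular $k$-chains with integer coefficients, $\partial$ the boundary operator, and $Z_k(X)\subseteq C_k(X)$ the subgroup of cycles. A Cheeger–Simons differential character of degree $2$ on $X$ is a group homomorphism $f:Z_1(X)\to U(1)$ for which there is a smooth real $2$-form $\eta$ on $X$ with $$f(\partial\Sigma)=\exp\Big(2\pi i\int_\Sigma \eta\Big)\qquad\text{for every }\Sigma\in C_2(X);$$ the form $\eta$ is uniquely determined by $f$ and is called the curvature $\operatorname{curv}(f)$. The set of these characters is denoted $\hat H^2(X)$. Regard $\lambda\in\Lambda$ as an element of $Z_1(X)$ through the linear cycle $t\mapsto t\lambda \bmod \Lambda$, $t\in[0,1]$. Theorem. Let $(\gamma_i)_i$ be a $\mathbb{Z}$-basis of $\Lambda$, and let $\omega$ be a smooth closed real $2$-form on $X$ with integral periods, i.e. $\int_c\omega\in\mathbb{Z}$ for every $c\in Z_2(X)$. Then for any choice of values $z_i\in U(1)$ there is a unique differential character $f\in\hat H^2(X)$ with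 $$\operatorname{curv}(f)=\omega\qquad\text{and}\qquad f(\gamma_i)=z_i\ \text{ for each } i.$$ -/

import Mathlib

/-! Smooth singular chains, differential forms and Cheeger-Simons differential characters on a
torus `X = V ⧸ Λ`, where `V` is a real normed space and `Λ` a lattice in `V`.

The smooth structure on `X` is the one for which the projection `Λ.mkQ : V → V ⧸ Λ` is a local
diffeomorphism, so smoothness of maps to `X` is tested on local lifts to `V`, smoothness of objects
on `X` is tested after pulling back to `V`, and every tangent space of `X` is `V` (through the
derivative of `Λ.mkQ`; two lifts of a point differ by a translation, whose derivative is the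
identity). -/

namespace Torus

noncomputable section

section Simplices

variable {V : Type*} [NormedAddCommGroup V] [NormedSpace ℝ V]

/-- `g` is a smooth lift of `σ : Δᵏ → V ⧸ Λ` near the point `p` of the standard simplex `Δᵏ`: it is
a `V`-valued map, smooth on an open neighbourhood `U` of `p` in `ℝᵏ⁺¹`, that lifts `σ` on
`U ∩ Δᵏ`. -/
def IsLocalLift (Λ : Submodule ℤ V) {k : ℕ} (σ : stdSimplex ℝ (Fin (k + 1)) → V ⧸ Λ)
    (p : stdSimplex ℝ (Fin (k + 1))) (g : (Fin (k + 1) → ℝ) → V) : Prop :=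
  ∃ U : Set (Fin (k + 1) → ℝ), IsOpen U ∧ (p : Fin (k + 1) → ℝ) ∈ U ∧ ContDiffOn ℝ (⊤ : ℕ∞) g U ∧
    ∀ q : stdSimplex ℝ (Fin (k + 1)), (q : Fin (k + 1) → ℝ) ∈ U → Λ.mkQ (g q) = σ q

/-- A smooth singular `k`-simplex in `V ⧸ Λ`. -/
structure SmoothSimplex (Λ : Submodule ℤ V) (k : ℕ) where
  toFun : stdSimplex ℝ (Fin (k + 1)) → V ⧸ Λ
  smooth' : ∀ p, ∃ g, IsLocalLift Λ toFun p g

/-- The `i`-th face `Δᵏ → Δᵏ⁺¹`, the affine map onto the face opposite to the `i`-th vertex. -/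
def faceMap {k : ℕ} (i : Fin (k + 2)) (p : stdSimplex ℝ (Fin (k + 1))) :
    stdSimplex ℝ (Fin (k + 2)) :=
  stdSimplex.map i.succAbove p

/-- The `i`-th face of a smooth singular simplex. -/
def SmoothSimplex.face {Λ : Submodule ℤ V} {k : ℕ} (σ : SmoothSimplex Λ (k + 1))
    (i : Fin (k + 2)) : SmoothSimplex Λ k where
  toFun p := σ.toFun (faceMap i p)
  smooth' p := by
    obtain ⟨g, U, hU, hp, hg, hlift⟩ := σ.smooth' (faceMap i p)
    let L : (Fin (k + 1) → ℝ) →L[ℝ] (Fin (k + 2) → ℝ) :=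
      LinearMap.toContinuousLinearMap (FunOnFinite.linearMap ℝ ℝ i.succAbove)
    exact ⟨g ∘ L, L ⁻¹' U, hU.preimage L.continuous, hp,
      hg.comp L.contDiff.contDiffOn (fun _ h => h), fun q hq => hlift (faceMap i q) hq⟩

/-- The group `C_k(X)` of smooth singular `k`-chains with integer coefficients. -/
abbrev Chain (Λ : Submodule ℤ V) (k : ℕ) : Type _ := SmoothSimplex Λ k →₀ ℤ

/-- The boundary operator `∂ σ = ∑ i, (-1) ^ i • (i-th face of σ)`. -/
def boundary (Λ : Submodule ℤ V) (k : ℕ) : Chain Λ (k + 1) →ₗ[ℤ] Chain Λ k :=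
  Finsupp.linearCombination ℤ fun σ : SmoothSimplex Λ (k + 1) =>
    ∑ i : Fin (k + 2), (-1 : ℤ) ^ (i : ℕ) • Finsupp.single (σ.face i) (1 : ℤ)

theorem boundary_single {Λ : Submodule ℤ V} {k : ℕ} (σ : SmoothSimplex Λ (k + 1)) :
    boundary Λ k (Finsupp.single σ 1) =
      ∑ i : Fin (k + 2), (-1 : ℤ) ^ (i : ℕ) • Finsupp.single (σ.face i) (1 : ℤ) := by
  rw [boundary, Finsupp.linearCombination_single, one_smul]

theorem face_face {Λ : Submodule ℤ V} {k : ℕ} (σ : SmoothSimplex Λ (k + 2)) (i : Fin (k + 3))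
    (j : Fin (k + 2)) :
    (σ.face (i.succAbove j)).face (j.predAbove i) = (σ.face i).face j := by
  simp only [SmoothSimplex.face, SmoothSimplex.mk.injEq]
  funext p
  simp only [faceMap, stdSimplex.map_comp_apply]
  congr 2
  funext x
  exact Fin.succAbove_succAbove_succAbove_predAbove i j x

theorem boundary_boundary {Λ : Submodule ℤ V} {k : ℕ} (c : Chain Λ (k + 2)) :
    boundary Λ k (boundary Λ (k + 1) c) = 0 := by
  suffices h : boundary Λ k ∘ₗ boundary Λ (k + 1) = 0 from LinearMap.congr_fun h c
  refine Finsupp.lhom_ext' fun σ => LinearMap.ext_ring ?_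
  simp only [LinearMap.comp_apply, Finsupp.lsingle_apply, boundary_single, map_sum, map_smul,
    LinearMap.zero_apply, Finset.smul_sum, smul_smul]
  rw [← Finset.sum_product']
  refine Finset.sum_involution (fun ij _ => (ij.1.succAbove ij.2, ij.2.predAbove ij.1))
    ?_ ?_ (fun _ _ => Finset.mem_univ _) ?_
  · rintro ⟨i, j⟩ -
    dsimp only
    rw [face_face, ← pow_add, ← pow_add, Fin.neg_one_pow_succAbove_add_predAbove, neg_smul,
      add_neg_cancel]
  · rintro ⟨i, j⟩ - - h
    exact Fin.succAbove_ne i j (congrArg Prod.fst h)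
  · rintro ⟨i, j⟩ -
    exact Prod.ext (Fin.succAbove_succAbove_predAbove i j) (Fin.predAbove_predAbove_succAbove i j)

/-- The group `Z_k(X)` of smooth singular `k`-cycles (all `0`-chains are cycles). -/
def cycles (Λ : Submodule ℤ V) : (k : ℕ) → Submodule ℤ (Chain Λ k)
  | 0 => ⊤
  | k + 1 => LinearMap.ker (boundary Λ k)

theorem boundary_mem_cycles {Λ : Submodule ℤ V} : ∀ {k : ℕ} (c : Chain Λ (k + 1)),
    boundary Λ k c ∈ cycles Λ k
  | 0, _ => Submodule.mem_top
  | _ + 1, c => LinearMap.mem_ker.mpr (boundary_boundary c)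

/-- The boundary of a chain, as a cycle. -/
def boundaryCycle {Λ : Submodule ℤ V} {k : ℕ} (c : Chain Λ (k + 1)) : cycles Λ k :=
  ⟨boundary Λ k c, boundary_mem_cycles c⟩

/-- The straight singular `1`-simplex `s ↦ s • v` mod `Λ`, starting at the origin of `V ⧸ Λ`, with
`s` the second barycentric coordinate on `Δ¹`. -/
def linearSimplex (Λ : Submodule ℤ V) (v : V) : SmoothSimplex Λ 1 where
  toFun p := Λ.mkQ (p 1 • v)
  smooth' _ := ⟨fun x => x 1 • v, Set.univ, isOpen_univ, Set.mem_univ _,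
    ((contDiff_apply ℝ ℝ (1 : Fin 2)).smul contDiff_const).contDiffOn, fun _ _ => rfl⟩

/-- The linear `1`-cycle of a lattice vector `v`: the image in `V ⧸ Λ` of the segment from `0` to
`v`. For primitive `v` it is the circle subgroup along `v`, traversed once in the direction of
`v`. -/
def linearCycle {Λ : Submodule ℤ V} (v : Λ) : cycles Λ 1 :=
  ⟨Finsupp.single (linearSimplex Λ (v : V)) 1, by
    have h : (linearSimplex Λ (v : V)).face 0 = (linearSimplex Λ (v : V)).face 1 := by
      simp only [SmoothSimplex.face, SmoothSimplex.mk.injEq]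
      funext p
      have hp : p 0 = 1 := by simp
      have h0 : (faceMap 0 p) 1 = 1 := by
        have hs : (Finset.univ.filter fun x : Fin 1 => (0 : Fin 2).succAbove x = 1) = {0} := by
          decide
        simp only [faceMap, stdSimplex.map_coe, FunOnFinite.linearMap_apply_apply]
        exact (congrArg (fun s => ∑ x ∈ s, p x) hs).trans ((Finset.sum_singleton _ _).trans hp)
      have h1 : (faceMap 1 p) 1 = 0 := by
        simp [faceMap, FunOnFinite.linearMap_apply_apply]
      simp only [linearSimplex, h0, h1, one_smul, zero_smul, map_zero]
      exact (Submodule.Quotient.mk_eq_zero Λ).mpr v.2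
    change boundary Λ 0 _ = 0
    rw [boundary_single, Fin.sum_univ_two, h]
    simp⟩

end Simplices

section Forms

variable {V : Type*} [NormedAddCommGroup V] [NormedSpace ℝ V]

/-- A smooth real-valued differential `k`-form on `V ⧸ Λ`. Each tangent space is identified with `V`
through the derivative of the projection, so that `fun v => ω (Λ.mkQ v)` is the pull-back of `ω`
to `V`. -/
@[ext]
structure Form (Λ : Submodule ℤ V) (k : ℕ) where
  toFun : V ⧸ Λ → V [⋀^Fin k]→L[ℝ] ℝ
  smooth' : ContDiff ℝ (⊤ : ℕ∞) fun v : V => toFun (Λ.mkQ v)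

/-- The pull-back of a form on `V ⧸ Λ` to `V`. -/
def Form.pullback {Λ : Submodule ℤ V} {k : ℕ} (ω : Form Λ k) : V → V [⋀^Fin k]→L[ℝ] ℝ :=
  fun v => ω.toFun (Λ.mkQ v)

/-- `ω` is closed: `dω = 0`. -/
def Form.IsClosed {Λ : Submodule ℤ V} {k : ℕ} (ω : Form Λ k) : Prop :=
  ∀ v : V, extDeriv ω.pullback v = 0

/-- The simplex `{t ∈ ℝᵏ | 0 ≤ tᵢ, ∑ tᵢ ≤ 1}`. -/
def cornerSimplex (k : ℕ) : Set (Fin k → ℝ) := {t | (∀ i, 0 ≤ t i) ∧ ∑ i, t i ≤ 1}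

/-- The affine parametrization `(t₁, …, t_k) ↦ (1 - ∑ tᵢ, t₁, …, t_k)` of `Δᵏ`. -/
def cornerToStd {k : ℕ} (t : cornerSimplex k) : stdSimplex ℝ (Fin (k + 1)) :=
  ⟨Fin.cons (1 - ∑ i, t.1 i) t.1, by
    refine ⟨fun j => ?_, ?_⟩
    · refine Fin.cases ?_ (fun i => ?_) j
      · simpa only [Fin.cons_zero, sub_nonneg] using t.2.2
      · simpa only [Fin.cons_succ] using t.2.1 i
    · simp only [Fin.sum_univ_succ, Fin.cons_zero, Fin.cons_succ, sub_add_cancel]⟩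

/-- The derivative of the singular simplex `σ` at `p`, in a direction `w` tangent to `Δᵏ` (the
coordinates of `w` sum to zero), as a vector of `V`. It is computed from a local lift; two local
lifts differ near `p` on `Δᵏ` by a constant of `Λ` when `Λ` is discrete. -/
def SmoothSimplex.deriv {Λ : Submodule ℤ V} {k : ℕ} (σ : SmoothSimplex Λ k)
    (p : stdSimplex ℝ (Fin (k + 1))) (w : Fin (k + 1) → ℝ) : V :=
  fderiv ℝ (σ.smooth' p).choose (p : Fin (k + 1) → ℝ) w

/-- The integral `∫_σ ω` of a `k`-form over a smooth singular `k`-simplex, that is, the integral over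
the parameters `t` of `ω` at `σ(t)`, evaluated on the partial derivatives of `σ`. -/
def Form.integralSimplex {Λ : Submodule ℤ V} {k : ℕ} (ω : Form Λ k) (σ : SmoothSimplex Λ k) : ℝ :=
  ∫ t : cornerSimplex k, ω.toFun (σ.toFun (cornerToStd t)) (fun i : Fin k =>
    σ.deriv (cornerToStd t) (Pi.single i.succ 1 - Pi.single 0 1))
      ∂(MeasureTheory.volume.comap (Subtype.val : cornerSimplex k → Fin k → ℝ))

/-- The integral `∫_c ω` of a `k`-form over a smooth singular `k`-chain. -/
def Form.integral {Λ : Submodule ℤ V} {k : ℕ} (ω : Form Λ k) : Chain Λ k →ₗ[ℤ] ℝ :=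
  Finsupp.linearCombination ℤ fun σ : SmoothSimplex Λ k => ω.integralSimplex σ

/-- `ω` has integral periods. -/
def Form.HasIntegralPeriods {Λ : Submodule ℤ V} {k : ℕ} (ω : Form Λ k) : Prop :=
  ∀ c ∈ cycles Λ k, ∃ n : ℤ, ω.integral c = n

/-- The condition `f(∂c) = exp(2πi ∫_c ω)` for every `(k+1)`-chain `c`, for a homomorphism
`f : Z_k(X) → U(1)` and a `(k+1)`-form `ω`. -/
def IsCurvature {Λ : Submodule ℤ V} {k : ℕ} (f : AddChar (cycles Λ k) Circle)
    (ω : Form Λ (k + 1)) : Prop :=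
  ∀ c : Chain Λ (k + 1), f (boundaryCycle c) = Circle.exp (2 * Real.pi * ω.integral c)

/-- The Cheeger-Simons differential characters of degree `d + 1` on `V ⧸ Λ`: the homomorphisms
`f : Z_d(X) → U(1)` that have a curvature form. -/
structure DifferentialCharacter (Λ : Submodule ℤ V) (d : ℕ) where
  toAddChar : AddChar (cycles Λ d) Circle
  exists_curvature : ∃ ω : Form Λ (d + 1), IsCurvature toAddChar ω

/-- The curvature `curv f` of a differential character. -/
def DifferentialCharacter.curv {Λ : Submodule ℤ V} {d : ℕ} (f : DifferentialCharacter Λ d) :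
    Form Λ (d + 1) :=
  f.exists_curvature.choose

end Forms

end

end Torus

/-! The point is that `Z_1` is the direct sum of the boundaries `B_1` and the free group on the
linear cycles of the basis, i.e. `H_1(X) = Λ`, split by the basis. Curvature `ω` prescribes a
character on `B_1`, its values on the linear cycles are free, and the two prescriptions together
determine it.

Spanning (`exists_eq_boundaryCycle_add`): a singular path lifts to `V`, and coning the lift to `0`
makes it homologous to two radial segments. In a cycle the contributions of the endpoints cancel up
to lattice vectors, which leaves linear cycles. Independence (`linearCycle_linearIndependent`): the
displacement of lifts kills boundaries and sends the linear cycle of `v` to `v`.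

On `B_1` the rule `∂τ ↦ exp(2πi ∫_τ ω)` is well defined because `∂τ = 0` forces `∫_τ ω ∈ ℤ`. Since
`curv` is a chosen form, one also needs that a character has only one curvature
(`isCurvature_unique`): integrals of two candidates over small triangles differ by integers of
absolute value below `1`, hence agree, and shrinking the triangles recovers the forms pointwise. -/

open Filter Topology

namespace Torus

noncomputable section

/-! ### Lifting smooth simplices from `V ⧸ Λ` to `V` -/

section Lifts

variable {V : Type*} [NormedAddCommGroup V]

/-- A function tending to an element of a discrete subgroup through elements of the subgroup is
eventually constant. -/
theorem eventually_eq_of_tendsto_of_mem {Λ : Submodule ℤ V} [DiscreteTopology Λ] {X : Type*}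
    {l : Filter X} {c : X → V} {C : V} (hc : Tendsto c l (𝓝 C)) (hmem : ∀ᶠ x in l, c x ∈ Λ)
    (hC : C ∈ Λ) : ∀ᶠ x in l, c x = C := by
  obtain ⟨U, hU, hUC⟩ := isOpen_induced_iff.mp (isOpen_discrete {(⟨C, hC⟩ : Λ)})
  have hCU : C ∈ U := (Set.ext_iff.mp hUC ⟨C, hC⟩).mpr rfl
  filter_upwards [hc (hU.mem_nhds hCU), hmem] with x hxU hx
  exact congrArg Subtype.val ((Set.ext_iff.mp hUC ⟨c x, hx⟩).mp hxU)

theorem mkQ_eq_mkQ_iff {Λ : Submodule ℤ V} {v w : V} : Λ.mkQ v = Λ.mkQ w ↔ v - w ∈ Λ :=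
  Submodule.Quotient.eq Λ

theorem isCoveringMap_mkQ (Λ : Submodule ℤ V) [DiscreteTopology Λ] : IsCoveringMap Λ.mkQ :=
  (Λ.isOpenQuotientMap_mkQ.isQuotientMap.isAddQuotientCoveringMap_of_addSubgroup Λ.toAddSubgroup
    ⟨‹_›⟩ (by
      intro v w
      rw [eq_comm, mkQ_eq_mkQ_iff, sub_eq_add_neg]
      rfl)).isCoveringMap

/-- Two continuous lifts of a map from the simplex differ by a constant. -/
theorem lift_sub_eq {Λ : Submodule ℤ V} [DiscreteTopology Λ] {k : ℕ}
    {F G : stdSimplex ℝ (Fin (k + 1)) → V} (hF : Continuous F) (hG : Continuous G)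
    (h : ∀ p, Λ.mkQ (F p) = Λ.mkQ (G p)) (p q : stdSimplex ℝ (Fin (k + 1))) :
    F p - F q = G p - G q := by
  -- `F - G` projects to the constant `0`; a continuous map from a connected space into a fibre of a
  -- covering is constant.
  have := (isCoveringMap_mkQ Λ).const_of_comp (g := fun p => F p - G p) (hF.sub hG)
    (fun a b => by simp only [map_sub, h, sub_self]) p q
  exact sub_eq_sub_iff_sub_eq_sub.mp this

variable [NormedSpace ℝ V]

/-- A smooth map from the standard simplex to a vector space: one with smooth local extensions. -/
def IsSmooth {k : ℕ} (F : stdSimplex ℝ (Fin (k + 1)) → V) : Prop :=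
  ∀ p : stdSimplex ℝ (Fin (k + 1)), ∃ (g : (Fin (k + 1) → ℝ) → V) (U : Set (Fin (k + 1) → ℝ)),
    IsOpen U ∧ (p : Fin (k + 1) → ℝ) ∈ U ∧ ContDiffOn ℝ (⊤ : ℕ∞) g U ∧
      ∀ q : stdSimplex ℝ (Fin (k + 1)), (q : Fin (k + 1) → ℝ) ∈ U → g q = F q

theorem IsSmooth.of_contDiff {k : ℕ} {g : (Fin (k + 1) → ℝ) → V} (hg : ContDiff ℝ (⊤ : ℕ∞) g) :
    IsSmooth fun p : stdSimplex ℝ (Fin (k + 1)) => g p :=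
  fun _ => ⟨g, Set.univ, isOpen_univ, Set.mem_univ _, hg.contDiffOn, fun _ _ => rfl⟩

theorem IsSmooth.comp_map {k l : ℕ} {F : stdSimplex ℝ (Fin (k + 1)) → V} (hF : IsSmooth F)
    (f : Fin (l + 1) → Fin (k + 1)) : IsSmooth fun p => F (stdSimplex.map f p) := by
  intro p
  obtain ⟨g, U, hU, hp, hg, h⟩ := hF (stdSimplex.map f p)
  let L : (Fin (l + 1) → ℝ) →L[ℝ] (Fin (k + 1) → ℝ) :=
    LinearMap.toContinuousLinearMap (FunOnFinite.linearMap ℝ ℝ f)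
  exact ⟨g ∘ L, L ⁻¹' U, hU.preimage L.continuous, hp,
    hg.comp L.contDiff.contDiffOn (fun _ h => h), fun q hq => h (stdSimplex.map f q) hq⟩

theorem IsSmooth.smul {k : ℕ} {a : stdSimplex ℝ (Fin (k + 1)) → ℝ}
    {F : stdSimplex ℝ (Fin (k + 1)) → V} (ha : IsSmooth a) (hF : IsSmooth F) :
    IsSmooth fun p => a p • F p := by
  intro p
  obtain ⟨g, U, hU, hp, hg, h⟩ := hF p
  obtain ⟨b, W, hW, hpW, hb, hbW⟩ := ha p
  exact ⟨fun x => b x • g x, W ∩ U, hW.inter hU, ⟨hpW, hp⟩,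
    (hb.mono Set.inter_subset_left).smul (hg.mono Set.inter_subset_right),
    fun q hq => by simp only [h q hq.2, hbW q hq.1]⟩

/-- The projection to `V ⧸ Λ` of a smooth map from the standard simplex to `V`. -/
def SmoothSimplex.proj (Λ : Submodule ℤ V) {k : ℕ} (F : stdSimplex ℝ (Fin (k + 1)) → V)
    (hF : IsSmooth F) : SmoothSimplex Λ k where
  toFun p := Λ.mkQ (F p)
  smooth' p := by
    obtain ⟨g, U, hU, hp, hg, h⟩ := hF p
    exact ⟨g, U, hU, hp, hg, fun q hq => congrArg Λ.mkQ (h q hq)⟩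

theorem SmoothSimplex.ext {Λ : Submodule ℤ V} {k : ℕ} {σ τ : SmoothSimplex Λ k}
    (h : ∀ p, σ.toFun p = τ.toFun p) : σ = τ := by
  obtain ⟨s, hs⟩ := σ
  obtain ⟨t, ht⟩ := τ
  obtain rfl : s = t := funext h
  rfl

theorem SmoothSimplex.continuous {Λ : Submodule ℤ V} {k : ℕ} (σ : SmoothSimplex Λ k) :
    Continuous σ.toFun := by
  refine continuous_iff_continuousAt.mpr fun p => ?_
  obtain ⟨g, U, hU, hp, hg, h⟩ := σ.smooth' p
  have hgp : ContinuousAt (fun q : stdSimplex ℝ (Fin (k + 1)) => g q) p :=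
    (hg.continuousOn.continuousAt (hU.mem_nhds hp)).comp continuous_subtype_val.continuousAt
  refine (Λ.isOpenQuotientMap_mkQ.continuous.continuousAt.comp hgp).congr ?_
  filter_upwards [(hU.preimage continuous_subtype_val).mem_nhds hp] with q hq using h q hq

instance simplyConnectedSpace_stdSimplex (k : ℕ) :
    SimplyConnectedSpace (stdSimplex ℝ (Fin (k + 1))) :=
  have := (convex_stdSimplex ℝ (Fin (k + 1))).contractibleSpace ⟨_, single_mem_stdSimplex ℝ 0⟩
  inferInstance

/-- The simplex is simply connected and locally path connected, so the covering `Λ.mkQ` provides a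
continuous lift. It inherits smoothness from the local lifts, from which it differs by locally
constant lattice vectors. -/
theorem SmoothSimplex.exists_lift {Λ : Submodule ℤ V} [DiscreteTopology Λ] {k : ℕ}
    (σ : SmoothSimplex Λ k) : ∃ F : stdSimplex ℝ (Fin (k + 1)) → V,
      Continuous F ∧ IsSmooth F ∧ ∀ p, Λ.mkQ (F p) = σ.toFun p := by
  have := (convex_stdSimplex ℝ (Fin (k + 1))).locallyPathConnectedSpace
  obtain ⟨e, he⟩ := Λ.mkQ_surjective (σ.toFun (stdSimplex.vertex 0))
  obtain ⟨F, ⟨-, hF⟩, -⟩ := (isCoveringMap_mkQ Λ).existsUnique_continuousMap_lifts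
    ⟨σ.toFun, σ.continuous⟩ (stdSimplex.vertex 0) e he
  have hF' : ∀ p, Λ.mkQ (F p) = σ.toFun p := fun p => congrFun hF p
  refine ⟨F, F.continuous, fun p => ?_, hF'⟩
  obtain ⟨g, U, hU, hp, hg, h⟩ := σ.smooth' p
  have hgp : ContinuousAt (fun q : stdSimplex ℝ (Fin (k + 1)) => g q) p :=
    (hg.continuousOn.continuousAt (hU.mem_nhds hp)).comp continuous_subtype_val.continuousAt
  have hmem : ∀ q : stdSimplex ℝ (Fin (k + 1)), (q : Fin (k + 1) → ℝ) ∈ U → F q - g q ∈ Λ :=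
    fun q hq => mkQ_eq_mkQ_iff.mp ((hF' q).trans (h q hq).symm)
  have hev := eventually_eq_of_tendsto_of_mem
    ((F.continuous.continuousAt (x := p)).sub hgp).tendsto
    (eventually_of_mem ((hU.preimage continuous_subtype_val).mem_nhds hp) hmem) (hmem p hp)
  obtain ⟨W, hW, hWF⟩ := mem_nhds_induced _ _ _ |>.mp hev
  obtain ⟨W', hW', hWo, hpW⟩ := mem_nhds_iff.mp hW
  -- The smooth extension is the local lift translated by its lattice offset from `F` at `p`; on
  -- `W'` the offset keeps this value.
  refine ⟨fun x => g x + (F p - g p), U ∩ W', hU.inter hWo, ⟨hp, hpW⟩,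
    (hg.mono Set.inter_subset_left).add contDiffOn_const, fun q hq => ?_⟩
  have : F q - g q = F p - g p := hWF (hW' hq.2)
  change g q + (F p - g p) = F q
  rw [← this, add_sub_cancel]

end Lifts

/-! ### First homology: cycles modulo boundaries and the lattice -/

section Homology

variable {V : Type*} [NormedAddCommGroup V] [NormedSpace ℝ V] {Λ : Submodule ℤ V}

/-- The difference of the endpoints of a lift of a singular `1`-simplex. -/
def SmoothSimplex.displacement [DiscreteTopology Λ] (σ : SmoothSimplex Λ 1) : V :=
  σ.exists_lift.choose (stdSimplex.vertex 1) - σ.exists_lift.choose (stdSimplex.vertex 0)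

theorem SmoothSimplex.displacement_eq [DiscreteTopology Λ] (σ : SmoothSimplex Λ 1)
    {F : stdSimplex ℝ (Fin 2) → V} (hF : Continuous F) (h : ∀ p, Λ.mkQ (F p) = σ.toFun p) :
    σ.displacement = F (stdSimplex.vertex 1) - F (stdSimplex.vertex 0) :=
  lift_sub_eq σ.exists_lift.choose_spec.1 hF
    (fun p => (σ.exists_lift.choose_spec.2.2 p).trans (h p).symm) _ _

/-- The displacement of a `1`-chain. -/
def chainDisplacement (Λ : Submodule ℤ V) [DiscreteTopology Λ] : Chain Λ 1 →ₗ[ℤ] V :=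
  Finsupp.linearCombination ℤ SmoothSimplex.displacement

/-- One lift of the triangle restricts to lifts of all three edges, so the alternating sum of
endpoint differences telescopes. -/
theorem chainDisplacement_boundary [DiscreteTopology Λ] (c : Chain Λ 2) :
    chainDisplacement Λ (boundary Λ 1 c) = 0 := by
  suffices h : chainDisplacement Λ ∘ₗ boundary Λ 1 = 0 from LinearMap.congr_fun h c
  refine Finsupp.lhom_ext' fun σ => LinearMap.ext_ring ?_
  obtain ⟨F, hF, -, h⟩ := σ.exists_lift
  have key : ∀ i, (σ.face i).displacement =
      F (stdSimplex.vertex (i.succAbove 1)) - F (stdSimplex.vertex (i.succAbove 0)) := by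
    intro i
    rw [(σ.face i).displacement_eq (hF.comp (stdSimplex.continuous_map i.succAbove))
      fun p => h _]
    simp only [Function.comp_apply, stdSimplex.map_vertex]
  have h01 : (1 : Fin 3).succAbove 1 = 2 := by decide
  have h20 : (2 : Fin 3).succAbove 0 = 0 := by decide
  have h21 : (2 : Fin 3).succAbove 1 = 1 := by decide
  simp [boundary_single, chainDisplacement, Fin.sum_univ_three, key, h01, h20, h21]

theorem chainDisplacement_linearCycle [DiscreteTopology Λ] (v : Λ) :
    chainDisplacement Λ (linearCycle v : Chain Λ 1) = v := by
  have hF : Continuous fun p : stdSimplex ℝ (Fin 2) => p 1 • (v : V) :=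
    ((continuous_apply 1).comp continuous_subtype_val).smul continuous_const
  simp only [linearCycle, chainDisplacement, Finsupp.linearCombination_single, one_smul]
  rw [SmoothSimplex.displacement_eq _ hF fun p => rfl]
  simp

/-- The class of a singular `1`-simplex modulo boundaries. -/
def SmoothSimplex.toQuotient (σ : SmoothSimplex Λ 1) :
    Chain Λ 1 ⧸ LinearMap.range (boundary Λ 1) :=
  (LinearMap.range (boundary Λ 1)).mkQ (Finsupp.single σ 1)

theorem toQuotient_face (τ : SmoothSimplex Λ 2) :
    (τ.face 0).toQuotient - (τ.face 1).toQuotient + (τ.face 2).toQuotient = 0 := by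
  have h : (LinearMap.range (boundary Λ 1)).mkQ (boundary Λ 1 (Finsupp.single τ 1)) = 0 :=
    (Submodule.Quotient.mk_eq_zero _).mpr ⟨_, rfl⟩
  rw [boundary_single, Fin.sum_univ_three] at h
  simpa [SmoothSimplex.toQuotient, sub_eq_add_neg] using h

theorem isSmooth_coord {k : ℕ} (i : Fin (k + 1)) :
    IsSmooth fun p : stdSimplex ℝ (Fin (k + 1)) => p i :=
  IsSmooth.of_contDiff (contDiff_apply ℝ ℝ i)

theorem isSmooth_const {k : ℕ} (v : V) :
    IsSmooth fun _ : stdSimplex ℝ (Fin (k + 1)) => v :=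
  IsSmooth.of_contDiff contDiff_const

/-- The class of the segment from `v` to `0` modulo boundaries. -/
def toOrigin (Λ : Submodule ℤ V) (v : V) : Chain Λ 1 ⧸ LinearMap.range (boundary Λ 1) :=
  (SmoothSimplex.proj Λ (fun p : stdSimplex ℝ (Fin 2) => p 0 • v)
    ((isSmooth_coord 0).smul (isSmooth_const v))).toQuotient

/-- All faces of a constant triangle coincide, and their alternating sum `a - a + a` is `a`. -/
theorem toQuotient_const (v : V) :
    (SmoothSimplex.proj Λ (fun _ : stdSimplex ℝ (Fin 2) => v) (isSmooth_const v)).toQuotient = 0 :=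
  (by simp [SmoothSimplex.face, SmoothSimplex.proj] : _ = _).symm.trans (toQuotient_face
    (SmoothSimplex.proj Λ (fun _ : stdSimplex ℝ (Fin 3) => v) (isSmooth_const v)))

theorem map_apply_eq_sum {m n : ℕ} (f : Fin m → Fin n) (p : stdSimplex ℝ (Fin m)) (j : Fin n) :
    stdSimplex.map f p j = ∑ i, if f i = j then p i else 0 := by
  rw [stdSimplex.map_coe, FunOnFinite.linearMap_apply_apply, Finset.sum_filter]

/-- A path is homologous, relative to its endpoints, to the concatenation of the segments from its
origin to `0` and from `0` to its end: contract the path linearly to `0`, and cut the square of this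
homotopy into two triangles. -/
theorem toQuotient_proj {F : stdSimplex ℝ (Fin 2) → V} (hF : IsSmooth F) :
    (SmoothSimplex.proj Λ F hF).toQuotient =
      toOrigin Λ (F (stdSimplex.vertex 0)) - toOrigin Λ (F (stdSimplex.vertex 1)) := by
  -- Vertex maps of the two triangles of the square, one used for the path parameter and the other
  -- for the scaling factor. Both triangles share the diagonal `p ↦ p 0 • F p`. The other edges are,
  -- in `hA`, the path and the segment from its end to `0`; in `hB`, the segment from its origin to
  -- `0` and a constant path.
  let f : Fin 3 → Fin 2 := ![0, 1, 1]
  let g : Fin 3 → Fin 2 := ![0, 0, 1]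
  have hA := toQuotient_face (SmoothSimplex.proj Λ
    (fun p : stdSimplex ℝ (Fin 3) => stdSimplex.map g p 0 • F (stdSimplex.map f p))
    (((isSmooth_coord 0).comp_map g).smul (hF.comp_map f)))
  have hB := toQuotient_face (SmoothSimplex.proj Λ
    (fun p : stdSimplex ℝ (Fin 3) => stdSimplex.map f p 0 • F (stdSimplex.map g p))
    (((isSmooth_coord 0).comp_map f).smul (hF.comp_map g)))
  have hf0 : f ∘ Fin.succAbove 0 = fun _ => 1 := by decide
  have hg0 : g ∘ Fin.succAbove 0 = id := by decide
  have hf1 : f ∘ Fin.succAbove 1 = id := by decide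
  have hg1 : g ∘ Fin.succAbove 1 = id := by decide
  have hf2 : f ∘ Fin.succAbove 2 = id := by decide
  have hg2 : g ∘ Fin.succAbove 2 = fun _ => 0 := by decide
  have hc : ∀ (i : Fin 2) (p : stdSimplex ℝ (Fin 2)),
      stdSimplex.map (fun _ : Fin 2 => i) p = stdSimplex.vertex i := by
    intro i p
    ext j
    rw [map_apply_eq_sum]
    have := stdSimplex.add_eq_one p
    by_cases h : i = j
    · subst h; simp
    · simp [h, Ne.symm h]
  have hz := toQuotient_const (Λ := Λ) (0 : V)
  simp only [SmoothSimplex.face, SmoothSimplex.proj, faceMap, stdSimplex.map_comp_apply, hf0, hf1,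
    hf2, hg0, hg1, hg2, hc, stdSimplex.map_id_apply, stdSimplex.vertex_coe, Pi.single_apply,
    zero_smul, one_smul, if_true, zero_ne_one, if_false] at hA hB hz
  rw [hz] at hB
  rw [zero_sub, neg_add_eq_zero] at hB
  rw [hB] at hA
  simp only [toOrigin, SmoothSimplex.proj]
  rw [← sub_eq_zero, ← hA]
  abel

theorem toOrigin_zero : toOrigin Λ (0 : V) = 0 :=
  (congrArg SmoothSimplex.toQuotient
    (SmoothSimplex.ext fun p => congrArg Λ.mkQ (smul_zero (p 0)))).trans (toQuotient_const (0 : V))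

/-- Translation by `w ∈ Λ` is invisible in the quotient, so the segment may be lifted to start at
`w`. Comparing this with the lift starting at `0` gives the additivity of `toOrigin`. -/
theorem toQuotient_linearSimplex {w : V} (hw : w ∈ Λ) (v : V) :
    (linearSimplex Λ v).toQuotient = toOrigin Λ w - toOrigin Λ (w + v) := by
  have hF : IsSmooth fun p : stdSimplex ℝ (Fin 2) => w + p 1 • v :=
    IsSmooth.of_contDiff (g := fun x => w + x 1 • v)
      (contDiff_const.add ((contDiff_apply ℝ ℝ (1 : Fin 2)).smul contDiff_const))
  have h : linearSimplex Λ v = SmoothSimplex.proj Λ _ hF :=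
    SmoothSimplex.ext fun p => mkQ_eq_mkQ_iff.mpr (by simpa using hw)
  rw [h, toQuotient_proj]
  simp

theorem toOrigin_add {w : V} (hw : w ∈ Λ) (v : V) :
    toOrigin Λ (w + v) = toOrigin Λ w + toOrigin Λ v := by
  have h := (toQuotient_linearSimplex hw v).symm.trans
    (toQuotient_linearSimplex (zero_mem Λ) v)
  rw [toOrigin_zero, zero_add, zero_sub, sub_eq_iff_eq_add] at h
  rw [h]
  abel

/-- The class of the segment from a lattice vector to `0`, as a homomorphism. -/
def latticeToOrigin (Λ : Submodule ℤ V) :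
    Λ →ₗ[ℤ] Chain Λ 1 ⧸ LinearMap.range (boundary Λ 1) :=
  AddMonoidHom.toIntLinearMap
    { toFun := fun w => toOrigin Λ (w : V)
      map_zero' := toOrigin_zero
      map_add' := fun w v => toOrigin_add w.2 (v : V) }

theorem mkQ_linearCycle (w : Λ) :
    (LinearMap.range (boundary Λ 1)).mkQ (linearCycle w : Chain Λ 1) = -latticeToOrigin Λ w := by
  refine (toQuotient_linearSimplex (zero_mem Λ) (w : V)).trans ?_
  rw [toOrigin_zero, zero_add, zero_sub]
  rfl

/-- The class of the segment from `0` to a fixed representative of a point of `V ⧸ Λ`, extended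
linearly to `0`-chains. -/
def pointFromOrigin (Λ : Submodule ℤ V) :
    Chain Λ 0 →ₗ[ℤ] Chain Λ 1 ⧸ LinearMap.range (boundary Λ 1) :=
  Finsupp.linearCombination ℤ fun σ : SmoothSimplex Λ 0 =>
    -toOrigin Λ (Function.surjInv Λ.mkQ_surjective (σ.toFun (stdSimplex.vertex 0)))

theorem toOrigin_eq (v : V) : ∃ w : Λ,
    toOrigin Λ v = latticeToOrigin Λ w +
      toOrigin Λ (Function.surjInv Λ.mkQ_surjective (Λ.mkQ v)) := by
  have h : v - Function.surjInv Λ.mkQ_surjective (Λ.mkQ v) ∈ Λ :=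
    mkQ_eq_mkQ_iff.mp (Function.surjInv_eq Λ.mkQ_surjective _).symm
  refine ⟨⟨_, h⟩, (congrArg (toOrigin Λ) (sub_add_cancel _ _).symm).trans (toOrigin_add h _)⟩

/-- The first term depends only on the boundary of `c`, so it vanishes on cycles and leaves a
lattice class. -/
theorem exists_mkQ_eq [DiscreteTopology Λ] (c : Chain Λ 1) : ∃ w : Λ,
    (LinearMap.range (boundary Λ 1)).mkQ c =
      pointFromOrigin Λ (boundary Λ 0 c) + latticeToOrigin Λ w := by
  induction c using Finsupp.induction_linear with
  | zero => exact ⟨0, by simp⟩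
  | add c d hc hd =>
    obtain ⟨w, hw⟩ := hc
    obtain ⟨u, hu⟩ := hd
    refine ⟨w + u, ?_⟩
    rw [map_add, hw, hu, map_add, map_add, map_add]
    abel
  | single σ n =>
    suffices h : ∃ w : Λ, (LinearMap.range (boundary Λ 1)).mkQ (Finsupp.single σ 1) =
        pointFromOrigin Λ (boundary Λ 0 (Finsupp.single σ 1)) + latticeToOrigin Λ w by
      obtain ⟨w, hw⟩ := h
      refine ⟨n • w, ?_⟩
      have hn : Finsupp.single σ n = n • (Finsupp.single σ 1 : Chain Λ 1) := by simp
      rw [hn, map_smul, hw, map_smul, map_smul, map_smul, smul_add]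
    obtain ⟨F, -, hF, h⟩ := σ.exists_lift
    obtain rfl : SmoothSimplex.proj Λ F hF = σ := SmoothSimplex.ext h
    obtain ⟨u, hu⟩ := toOrigin_eq (Λ := Λ) (F (stdSimplex.vertex 0))
    obtain ⟨w, hw⟩ := toOrigin_eq (Λ := Λ) (F (stdSimplex.vertex 1))
    -- `u` and `w` are the lattice offsets of the lifted endpoints from the fixed representatives of
    -- their images.
    refine ⟨u - w, (toQuotient_proj hF).trans ?_⟩
    rw [hu, hw, boundary_single, Fin.sum_univ_two]
    have h10 : (1 : Fin 2).succAbove 0 = 0 := by decide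
    simp only [pointFromOrigin, map_add, Finsupp.linearCombination_single,
      SmoothSimplex.face, SmoothSimplex.proj, faceMap, stdSimplex.map_vertex, h10,
      Fin.succAbove_zero, Fin.succ_zero_eq_one, map_sub, Fin.val_zero, Fin.val_one, pow_zero,
      pow_one, one_smul, neg_smul, map_neg, neg_neg]
    abel

/-- Modulo boundaries, every `1`-cycle is a combination of the linear cycles of a lattice basis. -/
theorem exists_eq_boundaryCycle_add [DiscreteTopology Λ] {ι : Type*} (γ : Module.Basis ι ℤ Λ)
    (c : cycles Λ 1) : ∃ (τ : Chain Λ 2) (n : ι →₀ ℤ),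
      c = boundaryCycle τ + Finsupp.linearCombination ℤ (fun i => linearCycle (γ i)) n := by
  obtain ⟨w, hw⟩ := exists_mkQ_eq (c : Chain Λ 1)
  rw [show boundary Λ 0 (c : Chain Λ 1) = 0 from c.2, map_zero, zero_add] at hw
  -- The sign of `-γ.repr w` arises because `latticeToOrigin` runs towards `0` while linear cycles
  -- run away from it.
  have hc : (LinearMap.range (boundary Λ 1)).mkQ (c : Chain Λ 1) =
      (LinearMap.range (boundary Λ 1)).mkQ (Finsupp.linearCombination ℤ
        (fun i => (linearCycle (γ i) : Chain Λ 1)) (-γ.repr w)) := by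
    rw [hw, Finsupp.apply_linearCombination]
    simp only [Function.comp_def, mkQ_linearCycle]
    conv_lhs => rw [← γ.linearCombination_repr w, Finsupp.apply_linearCombination]
    simp [Finsupp.linearCombination_apply, Finsupp.sum, Function.comp_def]
  obtain ⟨τ, hτ⟩ := (Submodule.Quotient.eq _).mp hc
  refine ⟨τ, -γ.repr w, Subtype.ext ?_⟩
  have := Finsupp.apply_linearCombination ℤ (cycles Λ 1).subtype (fun i => linearCycle (γ i))
    (-γ.repr w)
  exact (sub_eq_iff_eq_add.mp hτ.symm).trans (congrArg (boundary Λ 1 τ + ·) this.symm)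

end Homology

/-! ### Integrals over small triangles and uniqueness of curvature -/

section Curvature

variable {V : Type*} [NormedAddCommGroup V] [NormedSpace ℝ V] {Λ : Submodule ℤ V}

theorem convex_cornerSimplex (k : ℕ) : Convex ℝ (cornerSimplex k) := by
  intro x hx y hy a b ha hb hab
  refine ⟨fun i => add_nonneg (mul_nonneg ha (hx.1 i)) (mul_nonneg hb (hy.1 i)), ?_⟩
  simp only [Pi.add_apply, Pi.smul_apply, smul_eq_mul, Finset.sum_add_distrib, ← Finset.mul_sum]
  calc a * ∑ i, x i + b * ∑ i, y i ≤ a * 1 + b * 1 :=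
        add_le_add (mul_le_mul_of_nonneg_left hx.2 ha) (mul_le_mul_of_nonneg_left hy.2 hb)
    _ = 1 := by rw [mul_one, mul_one, hab]

theorem isClosed_cornerSimplex (k : ℕ) : IsClosed (cornerSimplex k) := by
  rw [cornerSimplex, Set.ofPred_and, Set.ofPred_forall]
  exact (isClosed_iInter fun i => isClosed_le continuous_const (continuous_apply i)).inter
    (isClosed_le (continuous_finsetSum _ fun i _ => continuous_apply i) continuous_const)

theorem isCompact_cornerSimplex (k : ℕ) : IsCompact (cornerSimplex k) :=
  (isCompact_Icc (a := (0 : Fin k → ℝ)) (b := 1)).of_isClosed_subset (isClosed_cornerSimplex k)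
    fun _ ht => ⟨ht.1, fun i => (Finset.single_le_sum (fun j _ => ht.1 j)
      (Finset.mem_univ i)).trans ht.2⟩

/-- Used both for the uniqueness of derivatives within the simplex and for the positivity of its
volume. The witness has all `k` coordinates equal to `1/(k+1)`, with sum below `1`. -/
theorem nonempty_interior_cornerSimplex (k : ℕ) : (interior (cornerSimplex k)).Nonempty := by
  have hU : IsOpen {t : Fin k → ℝ | (∀ i, 0 < t i) ∧ ∑ i, t i < 1} := by
    rw [Set.ofPred_and, Set.ofPred_forall]
    exact (isOpen_iInter_of_finite fun i => isOpen_lt continuous_const (continuous_apply i)).inter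
      (isOpen_lt (continuous_finsetSum _ fun i _ => continuous_apply i) continuous_const)
  have hsub : {t : Fin k → ℝ | (∀ i, 0 < t i) ∧ ∑ i, t i < 1} ⊆ cornerSimplex k :=
    fun t ht => ⟨fun i => (ht.1 i).le, ht.2.le⟩
  refine ⟨fun _ => ((k : ℝ) + 1)⁻¹, interior_maximal hsub hU ⟨fun _ => by positivity, ?_⟩⟩
  have : (0 : ℝ) < k + 1 := by positivity
  simp only [Finset.sum_const, Finset.card_univ, Fintype.card_fin, nsmul_eq_mul]
  rw [← div_eq_mul_inv, div_lt_one this]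
  exact lt_add_one _

/-- The linear part of the affine parametrization of the standard simplex. -/
def cornerLinear (k : ℕ) : (Fin k → ℝ) →L[ℝ] (Fin (k + 1) → ℝ) :=
  ∑ i : Fin k, (ContinuousLinearMap.proj i).smulRight
    (Pi.single i.succ (1 : ℝ) - Pi.single 0 1 : Fin (k + 1) → ℝ)

theorem cornerLinear_single {k : ℕ} (i : Fin k) :
    cornerLinear k (Pi.single i 1) = Pi.single i.succ 1 - Pi.single 0 1 := by
  simp [cornerLinear, Pi.single_apply, ite_smul]

theorem coe_cornerToStd {k : ℕ} (t : cornerSimplex k) :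
    (cornerToStd t : Fin (k + 1) → ℝ) = Pi.single 0 1 + cornerLinear k t := by
  change (Fin.cons (1 - ∑ i, t.1 i) t.1 : Fin (k + 1) → ℝ) = _
  ext j
  refine Fin.cases ?_ (fun j => ?_) j
  · simp [cornerLinear, Finset.sum_apply, sub_eq_add_neg]
  · simp [cornerLinear, Finset.sum_apply, Pi.single_apply,
      Fin.succ_ne_zero]

/-- The derivative of a singular simplex, along the simplex, does not depend on the lift. -/
theorem SmoothSimplex.deriv_eq [DiscreteTopology Λ] {k : ℕ} (σ : SmoothSimplex Λ k)
    {g : (Fin (k + 1) → ℝ) → V} (hg : Differentiable ℝ g)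
    (h : ∀ p : stdSimplex ℝ (Fin (k + 1)), Λ.mkQ (g p) = σ.toFun p) (t : cornerSimplex k)
    (i : Fin k) :
    σ.deriv (cornerToStd t) (Pi.single i.succ 1 - Pi.single 0 1) =
      fderiv ℝ g (cornerToStd t) (Pi.single i.succ 1 - Pi.single 0 1) := by
  obtain ⟨U, hU, hp, hG, hlift⟩ := (σ.smooth' (cornerToStd t)).choose_spec
  unfold SmoothSimplex.deriv
  set G := (σ.smooth' (cornerToStd t)).choose
  -- Pulling back along the affine parametrization replaces `Δᵏ`, which has empty interior in
  -- `ℝᵏ⁺¹`, by a convex set with interior.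
  let A : (Fin k → ℝ) → Fin (k + 1) → ℝ := fun s => Pi.single 0 1 + cornerLinear k s
  have hAt : A t = cornerToStd t := (coe_cornerToStd t).symm
  have hA : HasFDerivAt A (cornerLinear k) t := (cornerLinear k).hasFDerivAt.const_add _
  have hGd : HasFDerivAt G (fderiv ℝ G (A t)) (A t) := by
    rw [hAt]
    exact ((hG.differentiableOn (by simp)).differentiableAt (hU.mem_nhds hp)).hasFDerivAt
  have hGA := hGd.comp t.1 hA
  have hgA := ((hg (A t)).hasFDerivAt).comp t.1 hA
  have hmem : ∀ᶠ s in 𝓝[cornerSimplex k] t.1, (G ∘ A - g ∘ A) s ∈ Λ := by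
    have hUA : A ⁻¹' U ∈ 𝓝 t.1 := hA.continuousAt (hU.mem_nhds (by rw [hAt]; exact hp))
    filter_upwards [mem_nhdsWithin_of_mem_nhds hUA, self_mem_nhdsWithin] with s hsU hs
    have hAs : A s = cornerToStd ⟨s, hs⟩ := (coe_cornerToStd ⟨s, hs⟩).symm
    refine mkQ_eq_mkQ_iff.mp ?_
    simp only [Function.comp_apply, hAs]
    exact (hlift _ (hAs ▸ hsU)).trans (h _).symm
  have hev := eventually_eq_of_tendsto_of_mem
    ((hGA.sub hgA).continuousAt.continuousWithinAt (s := cornerSimplex k)) hmem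
    (hmem.self_of_nhdsWithin t.2)
  -- The difference of the lifts is locally constant on the simplex, so `0` is one of its
  -- derivatives there, and by unique differentiability the only one.
  have h0 : HasFDerivWithinAt (G ∘ A - g ∘ A) (0 : (Fin k → ℝ) →L[ℝ] V) (cornerSimplex k) t.1 :=
    (hasFDerivWithinAt_const _ _ _).congr_of_eventuallyEq hev rfl
  have heq := (uniqueDiffOn_convex (convex_cornerSimplex k) (nonempty_interior_cornerSimplex k)
    t.1 t.2).eq h0 (hGA.sub hgA).hasFDerivWithinAt
  have := DFunLike.congr_fun heq (Pi.single i 1)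
  simp only [zero_apply, sub_apply,
    ContinuousLinearMap.comp_apply, cornerLinear_single, hAt] at this
  exact (sub_eq_zero.mp this.symm)

theorem contDiff_affineTriangle (p u w : V) :
    ContDiff ℝ (⊤ : ℕ∞) fun x : Fin 3 → ℝ => p + x 1 • u + x 2 • w :=
  (contDiff_const.add ((contDiff_apply ℝ ℝ 1).smul contDiff_const)).add
    ((contDiff_apply ℝ ℝ 2).smul contDiff_const)

/-- The affine triangle with vertices `p`, `p + u`, `p + w`. -/
def affineTriangle (Λ : Submodule ℤ V) (p u w : V) : SmoothSimplex Λ 2 :=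
  SmoothSimplex.proj Λ _ (IsSmooth.of_contDiff (contDiff_affineTriangle p u w))

/-- The global affine lift has constant partial derivatives `u` and `w`. The corner coordinates `t
0`, `t 1` are the barycentric coordinates `1` and `2`. -/
theorem Form.integralSimplex_affineTriangle [DiscreteTopology Λ] (ω : Form Λ 2) (p u w : V) :
    ω.integralSimplex (affineTriangle Λ p u w) =
      ∫ t in cornerSimplex 2, ω.pullback (p + t 0 • u + t 1 • w) ![u, w] := by
  rw [← MeasureTheory.integral_subtype_comap (isClosed_cornerSimplex 2).measurableSet
    fun t => ω.pullback (p + t 0 • u + t 1 • w) ![u, w]]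
  refine MeasureTheory.integral_congr_ae (Eventually.of_forall fun t => ?_)
  have hD : ∀ (x y : Fin 3 → ℝ),
      fderiv ℝ (fun x : Fin 3 → ℝ => p + x 1 • u + x 2 • w) x y = y 1 • u + y 2 • w := by
    intro x y
    have h1 := (ContinuousLinearMap.proj (R := ℝ) (φ := fun _ : Fin 3 => ℝ) 1).hasFDerivAt (x := x)
      |>.smul_const u
    have h2 := (ContinuousLinearMap.proj (R := ℝ) (φ := fun _ : Fin 3 => ℝ) 2).hasFDerivAt (x := x)
      |>.smul_const w
    exact DFunLike.congr_fun ((h1.const_add p).add h2).fderiv y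
  have hv : (fun i : Fin 2 => (affineTriangle Λ p u w).deriv (cornerToStd t)
      (Pi.single i.succ 1 - Pi.single 0 1)) = ![u, w] := by
    funext i
    rw [SmoothSimplex.deriv_eq _ ((contDiff_affineTriangle p u w).differentiable (by simp))
      fun _ => rfl, hD]
    fin_cases i <;> simp
  exact congrArg (ω.toFun _) hv

/-- Only the base point is scaled by `ε`, so the value at `ε = 0` is the area of the simplex times
the form at `p` on `(u, w)`. -/
theorem Form.continuous_integral_pullback (ω : Form Λ 2) (p u w : V) :
    Continuous fun ε : ℝ =>
      ∫ t in cornerSimplex 2, ω.pullback (p + t 0 • ε • u + t 1 • ε • w) ![u, w] := by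
  refine continuous_parametric_integral_of_continuous ?_ (isCompact_cornerSimplex 2)
  have h1 : Continuous ω.pullback := ω.smooth'.continuous
  have h2 : Continuous fun x : ℝ × (Fin 2 → ℝ) =>
      ω.pullback (p + x.2 0 • x.1 • u + x.2 1 • x.1 • w) := h1.comp (by fun_prop)
  exact (continuous_eval_const ![u, w]).comp h2

/-- Two forms whose integrals over `2`-simplices agree modulo `ℤ` are equal. -/
theorem Form.eq_of_integralSimplex_sub_mem [DiscreteTopology Λ] {ω η : Form Λ 2}
    (h : ∀ σ, ∃ n : ℤ, ω.integralSimplex σ - η.integralSimplex σ = n) : ω = η := by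
  refine Form.ext (funext fun x => ?_)
  obtain ⟨p, rfl⟩ := Λ.mkQ_surjective x
  ext v
  obtain ⟨u, w, rfl⟩ : ∃ u w, v = ![u, w] := ⟨v 0, v 1, by ext i; fin_cases i <;> rfl⟩
  let J : Form Λ 2 → ℝ → ℝ := fun ω ε =>
    ∫ t in cornerSimplex 2, ω.pullback (p + t 0 • ε • u + t 1 • ε • w) ![u, w]
  have hJ : ∀ ω, Continuous (J ω) := fun ω => ω.continuous_integral_pullback p u w
  have hscale : ∀ (ω : Form Λ 2) (ε : ℝ),
      ω.integralSimplex (affineTriangle Λ p (ε • u) (ε • w)) = ε ^ 2 * J ω ε := by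
    intro ω ε
    rw [Form.integralSimplex_affineTriangle, ← MeasureTheory.integral_const_mul]
    refine congrArg _ (funext fun t => ?_)
    have : ![ε • u, ε • w] = fun i => ε • ![u, w] i := by ext i; fin_cases i <;> rfl
    rw [this, ContinuousAlternatingMap.map_smul_univ]
    simp
  have hK : Continuous fun ε : ℝ => ε ^ 2 * J ω ε - ε ^ 2 * J η ε :=
    ((continuous_pow 2).mul (hJ ω)).sub ((continuous_pow 2).mul (hJ η))
  have hsmall : ∀ᶠ ε in 𝓝 (0 : ℝ), |ε ^ 2 * J ω ε - ε ^ 2 * J η ε| < 1 :=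
    hK.abs.continuousAt.eventually_lt continuousAt_const (by simp)
  -- An integer of absolute value below `1` is `0`; the factor `ε ^ 2` then cancels away from `ε =
  -- 0`, and continuity extends the equality to `0`.
  have heq : J ω =ᶠ[𝓝[≠] 0] J η := by
    filter_upwards [mem_nhdsWithin_of_mem_nhds hsmall, self_mem_nhdsWithin] with ε hε hε0
    obtain ⟨n, hn⟩ := h (affineTriangle Λ p (ε • u) (ε • w))
    rw [hscale, hscale] at hn
    rw [hn] at hε
    have hn0 : n = 0 := Int.abs_lt_one_iff.mp (by exact_mod_cast hε)
    rw [hn0, Int.cast_zero, ← mul_sub] at hn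
    exact sub_eq_zero.mp ((mul_eq_zero.mp hn).resolve_left (pow_ne_zero 2 hε0))
  have h0 : J ω 0 = J η 0 := tendsto_nhds_unique
    ((hJ ω).continuousAt.continuousWithinAt (s := {0}ᶜ))
    (((hJ η).continuousAt.continuousWithinAt (s := {0}ᶜ)).tendsto.congr' heq.symm)
  have hpos : 0 < MeasureTheory.volume.real (cornerSimplex 2) :=
    ENNReal.toReal_pos
      ((isOpen_interior.measure_pos _ (nonempty_interior_cornerSimplex 2)).trans_le
        (MeasureTheory.measure_mono interior_subset)).ne'
      (isCompact_cornerSimplex 2).measure_lt_top.ne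
  simpa [J, Form.pullback, hpos.ne'] using h0

theorem isCurvature_unique [DiscreteTopology Λ] {f : AddChar (cycles Λ 1) Circle}
    {ω η : Form Λ 2} (hω : IsCurvature f ω) (hη : IsCurvature f η) : ω = η := by
  refine Form.eq_of_integralSimplex_sub_mem fun σ => ?_
  obtain ⟨n, hn⟩ := Circle.exp_eq_exp.mp
    ((hω (Finsupp.single σ 1)).symm.trans (hη (Finsupp.single σ 1)))
  refine ⟨n, ?_⟩
  simp only [Form.integral, Finsupp.linearCombination_single, one_smul] at hn
  have : 2 * Real.pi * (ω.integralSimplex σ - η.integralSimplex σ - n) = 0 := by linarith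
  exact sub_eq_zero.mp ((mul_eq_zero.mp this).resolve_left Real.two_pi_pos.ne')

end Curvature

/-! ### Construction and uniqueness of the character -/

section Characters

variable {V : Type*} [NormedAddCommGroup V] [NormedSpace ℝ V] {Λ : Submodule ℤ V}

/-- Displacement kills the boundary and turns the relation into one among the basis vectors of `Λ`.
-/
theorem linearCycle_linearIndependent [DiscreteTopology Λ] {ι : Type*} (γ : Module.Basis ι ℤ Λ)
    {τ : Chain Λ 2} {n : ι →₀ ℤ}
    (h : boundaryCycle τ + Finsupp.linearCombination ℤ (fun i => linearCycle (γ i)) n = 0) :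
    n = 0 := by
  have h' := congrArg (chainDisplacement Λ ∘ₗ (cycles Λ 1).subtype) h
  rw [map_add, map_zero, Finsupp.apply_linearCombination] at h'
  have h0 : (chainDisplacement Λ ∘ₗ (cycles Λ 1).subtype) (boundaryCycle τ) = 0 :=
    chainDisplacement_boundary τ
  have hγ : ⇑(chainDisplacement Λ ∘ₗ (cycles Λ 1).subtype) ∘ (fun i => linearCycle (γ i)) =
      ⇑Λ.subtype ∘ γ := funext fun i => chainDisplacement_linearCycle (γ i)
  rw [h0, zero_add, hγ, ← Finsupp.apply_linearCombination] at h'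
  exact (linearIndependent_iff.mp γ.linearIndependent) n
    (Subtype.ext (h'.trans (map_zero Λ.subtype).symm))

/-- The boundaries, together with the linear cycles of a lattice basis, parametrize the
`1`-cycles. -/
def cycleParametrization {ι : Type*} (γ : Module.Basis ι ℤ Λ) :
    Chain Λ 2 × (ι →₀ ℤ) →ₗ[ℤ] cycles Λ 1 :=
  ((boundary Λ 1).codRestrict (cycles Λ 1) boundary_mem_cycles).coprod
    (Finsupp.linearCombination ℤ fun i => linearCycle (γ i))

theorem cycleParametrization_surjective [DiscreteTopology Λ] {ι : Type*}
    (γ : Module.Basis ι ℤ Λ) : Function.Surjective (cycleParametrization γ) := by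
  intro c
  obtain ⟨τ, n, rfl⟩ := exists_eq_boundaryCycle_add γ c
  exact ⟨(τ, n), rfl⟩

/-- `x ↦ exp (2πix)` as a homomorphism. -/
def expHom : ℝ →+ Additive Circle where
  toFun x := Additive.ofMul (Circle.exp (2 * Real.pi * x))
  map_zero' := by simp
  map_add' x y := by
    rw [mul_add, Circle.exp_add]
    rfl

theorem expHom_intCast (n : ℤ) : expHom n = 0 :=
  congrArg Additive.ofMul (by
    rw [mul_comm]
    exact Circle.exp_int_mul_two_pi n)

/-- There is a character of `Z_1` with given integral curvature form and given values on the linear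
cycles of a lattice basis. -/
theorem exists_isCurvature [DiscreteTopology Λ] {ι : Type*} (γ : Module.Basis ι ℤ Λ)
    {ω : Form Λ 2} (hω : ω.HasIntegralPeriods) (z : ι → Circle) :
    ∃ f : AddChar (cycles Λ 1) Circle, IsCurvature f ω ∧ ∀ i, f (linearCycle (γ i)) = z i := by
  let Φ := (cycleParametrization γ).toAddMonoidHom
  let Ψ : Chain Λ 2 × (ι →₀ ℤ) →+ Additive Circle :=
    (expHom.comp ω.integral.toAddMonoidHom).coprod
      (Finsupp.linearCombination ℤ fun i => Additive.ofMul (z i)).toAddMonoidHom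
  -- The prescribed values `Ψ` descend to `Z_1`: a relation has `n = 0`, so `τ` is a cycle and its
  -- period is an integer.
  have hΨ : Φ.ker ≤ Ψ.ker := by
    rintro ⟨τ, n⟩ h
    have h' : boundaryCycle τ + Finsupp.linearCombination ℤ (fun i => linearCycle (γ i)) n = 0 := h
    obtain rfl := linearCycle_linearIndependent γ h'
    rw [map_zero, add_zero] at h'
    obtain ⟨m, hm⟩ := hω τ (congrArg Subtype.val h')
    change expHom (ω.integral τ) +
      Finsupp.linearCombination ℤ (fun i => Additive.ofMul (z i)) 0 = 0
    rw [hm, expHom_intCast, map_zero, add_zero]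
  let f := Φ.liftOfSurjective (cycleParametrization_surjective γ) ⟨Ψ, hΨ⟩
  have hf : ∀ x, f (Φ x) = Ψ x :=
    Φ.liftOfRightInverse_comp_apply _
      (Function.rightInverse_surjInv (cycleParametrization_surjective γ)) ⟨Ψ, hΨ⟩
  refine ⟨AddChar.toAddMonoidHomEquiv.symm f, fun τ => ?_, fun i => ?_⟩
  · have h : Φ (τ, 0) = boundaryCycle τ := by
      change boundaryCycle τ +
        Finsupp.linearCombination ℤ (fun i => linearCycle (γ i)) 0 = _
      rw [map_zero, add_zero]
    change (f (boundaryCycle τ)).toMul = _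
    rw [← h, hf]
    change (expHom (ω.integral τ) +
      Finsupp.linearCombination ℤ (fun i => Additive.ofMul (z i)) 0).toMul = _
    rw [map_zero, add_zero]
    rfl
  · have h : Φ (0, Finsupp.single i 1) = linearCycle (γ i) := by
      change boundaryCycle 0 +
        Finsupp.linearCombination ℤ (fun i => linearCycle (γ i)) (Finsupp.single i 1) = _
      rw [Finsupp.linearCombination_single, one_smul]
      exact (congrArg (· + _) (Subtype.ext (map_zero (boundary Λ 1)))).trans (zero_add _)
    change (f (linearCycle (γ i))).toMul = _
    rw [← h, hf]
    change (expHom (ω.integral 0) +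
      Finsupp.linearCombination ℤ (fun i => Additive.ofMul (z i)) (Finsupp.single i 1)).toMul = _
    rw [map_zero, map_zero, zero_add, Finsupp.linearCombination_single, one_smul]
    rfl

/-- A character of `Z_1` is determined by its curvature and its values on the linear cycles of a
lattice basis. -/
theorem addChar_ext_of_isCurvature [DiscreteTopology Λ] {ι : Type*} (γ : Module.Basis ι ℤ Λ)
    {ω : Form Λ 2} {f g : AddChar (cycles Λ 1) Circle} (hf : IsCurvature f ω)
    (hg : IsCurvature g ω) (h : ∀ i, f (linearCycle (γ i)) = g (linearCycle (γ i))) : f = g := by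
  have hlin : f.toAddMonoidHom.toIntLinearMap ∘ₗ
        Finsupp.linearCombination ℤ (fun i => linearCycle (γ i)) =
      g.toAddMonoidHom.toIntLinearMap ∘ₗ
        Finsupp.linearCombination ℤ (fun i => linearCycle (γ i)) := by
    refine Finsupp.lhom_ext' fun i => LinearMap.ext_ring ?_
    simp only [LinearMap.comp_apply, Finsupp.lsingle_apply, Finsupp.linearCombination_single,
      one_smul]
    exact congrArg Additive.ofMul (h i)
  ext1 c
  obtain ⟨τ, n, rfl⟩ := exists_eq_boundaryCycle_add γ c
  rw [AddChar.map_add_eq_mul, AddChar.map_add_eq_mul, hf, hg]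
  exact congrArg _ (congrArg Additive.toMul (LinearMap.congr_fun hlin n))

theorem DifferentialCharacter.isCurvature_curv {d : ℕ} (f : DifferentialCharacter Λ d) :
    IsCurvature f.toAddChar f.curv :=
  f.exists_curvature.choose_spec

end Characters

end

end Torus

theorem mainTheorem10 {V : Type*} [NormedAddCommGroup V] [NormedSpace ℂ V] [FiniteDimensional ℂ V]
    (Λ : Submodule ℤ V) [DiscreteTopology Λ] [IsZLattice ℝ Λ]
    {ι : Type*} (γ : Module.Basis ι ℤ Λ)
    (ω : Torus.Form Λ 2) (hclosed : ω.IsClosed) (hperiods : ω.HasIntegralPeriods)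
    (z : ι → Circle) :
    ∃! f : Torus.DifferentialCharacter Λ 1,
      f.curv = ω ∧ ∀ i, f.toAddChar (Torus.linearCycle (γ i)) = z i := by
  obtain ⟨f, hf, hfz⟩ := Torus.exists_isCurvature γ hperiods z
  -- The curvature selected by `curv` need not be `ω` by definition; uniqueness of curvature
  -- identifies them.
  refine ⟨⟨f, ω, hf⟩, ⟨Torus.isCurvature_unique
    (Torus.DifferentialCharacter.isCurvature_curv _) hf, hfz⟩, ?_⟩
  rintro ⟨g, hg⟩ ⟨hcurv, hgz⟩
  have hgω : Torus.IsCurvature g ω :=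
    hcurv ▸ Torus.DifferentialCharacter.isCurvature_curv ⟨g, hg⟩
  obtain rfl : g = f := Torus.addChar_ext_of_isCurvature γ hgω hf
    fun i => (hgz i).trans (hfz i).symm
  rfl
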